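/- Let $d\ge 1$, $\Omega=\prod_{i=1}^d(\check a_i,\hat a_i)$, $\alpha_i\in(1,2)$, $K_i>0$ $(1\le i\le d)$, and let $r:\Omega\times(0,T_{\rm end}]\to\mathbb R$ satisfy $0<c\le r(\boldsymbol x,t)\le C$ for some constants $c,C$. Let $n_1,\dots,n_d\ge 1$, $M\ge 1$ and $0\le m\le M-1$ be integers, and put $\Delta t=T_{\rm end}/M$, $t_{m+\frac12}=(m+\tfrac12)\Delta t$, $h_i=(\hat a_i-\check a_i)/(n_i+1)$, $\eta_i=K_i\Delta t/(2h_i^{\alpha_i})$. For $k\in\mathbb Z$ and $\alpha\in(1,2)$ let $$g_k^{(\alpha)}=\frac{(-1)^k\Gamma(\alpha+1)}{\Gamma(\frac\alpha2-k+1)\Gamma(\frac\alpha2+k+1)},\qquad s_k^{(\alpha)}=g_k^{(\alpha)}\Big[1+\frac{\alpha(\alpha+1)(\alpha+2)}{6(\alpha-2k+2)(\alpha+2k+2)}\Big],$$ and let $S_n^{(\alpha)}=(s^{(\alpha)}_{i-j})_{i,j=1}^n$, $\hat S_n^{(\alpha)}=(g^{(\alpha)}_{i-j})_{i,j=1}^n$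 be the Toeplitz matrices of the fourth-order and second-order fractional centred differences. Let $\tau(\hat S_n^{(\alpha)})=\hat S_n^{(\alpha)}-H_n$ be the natural $\tau$ matrix, where $H_n$ is the Hankel matrix with $(p,q)$ entry $g^{(\alpha)}_{p+q}$ if $p+q\le n-1$, $g^{(\alpha)}_{2n+2-p-q}$ if $p+q\ge n+3$, and $0$ otherwise. Let $Q_n=I_n+\frac{\alpha}{24}\,{\rm tridiag}(-1,2,-1)$ and $P_{\alpha}=Q_n\,\tau(\hat S_n^{(\alpha)})$, the size being $n=n_i$ for $\alpha=\alpha_i$. Index vectors by the multi-indices $\boldsymbol J=(j_1,\dots,j_d)$, $1\le j_i\le n_i$, of the interior grid nodes $\boldsymbol x_{\boldsymbol J}=(\check a_i+j_ih_i)_{i=1}^d$, and let $I\otimes B\otimes I$, with $B$ in the $i$-th factor, denote the matrix $B$ acting on the $i$-th index. Put $$D^{m+\frac12}={\rm diag}\big(r(\boldsymbol x_{\boldsymbol J},t_{m+\frac12})\big)_{\boldsymbol J},\qquad T=\sum_{i=1}^d\eta_i\, I\otimes S_{n_i}^{(\alpha_i)}\otimes I,\qquad P_\tau=\bar r\,I+\sum_{i=1}^d\eta_i\,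 I\otimes P_{\alpha_i}\otimes I,$$ where $\hat r=\sup_{\boldsymbol x\in\Omega}r(\boldsymbol x,t_{m+\frac12})$, $\check r=\inf_{\boldsymbol x\in\Omega}r(\boldsymbol x,t_{m+\frac12})$ and $\bar r$ is any number with $\check r\le\bar r\le\hat r$ (for example $\sqrt{\hat r\check r}$ or $(\hat r+\check r)/2$). Then $P_\tau$ is symmetric positive definite, hence invertible, and every eigenvalue $\lambda\in\mathbb C$ of $P_\tau^{-1}(D^{m+\frac12}+T)$ is real and satisfies $$\min\Big\{\frac{\check r}{\hat r},\frac38\Big\}\le\lambda\le\max\Big\{\frac{\hat r}{\check r},2\Big\}.$$ In particular the bounds do not depend on the mesh sizes $n_i$, $h_i$, $\Delta t$ other than through $\check r$ and $\hat r$ at the time $t_{m+\frac12}$. -/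

import Mathlib

noncomputable section

namespace RieszFD

/-- Coefficients of the second-order fractional centred difference, i.e. the Fourier coefficients
of `(2 - ω - ω⁻¹) ^ (α / 2)` on the unit circle. -/
def fcdCoeff (α : ℝ) (k : ℤ) : ℝ :=
  (-1) ^ k * Real.Gamma (α + 1) /
    (Real.Gamma (α / 2 - k + 1) * Real.Gamma (α / 2 + k + 1))

/-- Coefficients of the fourth-order fractional centred difference, i.e. the Fourier coefficients
of `(1 + α / 24 * (2 - ω - ω⁻¹)) * (2 - ω - ω⁻¹) ^ (α / 2)` on the unit circle. -/
def fcd4Coeff (α : ℝ) (k : ℤ) : ℝ :=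
  (-1) ^ k * Real.Gamma (α + 1) /
    (Real.Gamma (α / 2 - k + 1) * Real.Gamma (α / 2 + k + 1)) *
    (1 + α * (α + 1) * (α + 2) / (6 * (α - 2 * k + 2) * (α + 2 * k + 2)))

/-- The `n × n` Toeplitz matrix with entries `t (i - j)`. -/
def toeplitz (t : ℤ → ℝ) (n : ℕ) : Matrix (Fin n) (Fin n) ℝ :=
  Matrix.of fun i j => t ((i : ℤ) - (j : ℤ))

/-- The Hankel matrix with first column `(t 2, t 3, …, t (n-1), 0, 0)` and last column
`(0, 0, t (n-1), …, t 3, t 2)`.  With one-based indices `p = i + 1`, `q = j + 1` the entry is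
`t (p + q)` if `p + q ≤ n - 1`, `t (2 * n + 2 - p - q)` if `p + q ≥ n + 3`, and `0` otherwise. -/
def tauHankel (t : ℤ → ℝ) (n : ℕ) : Matrix (Fin n) (Fin n) ℝ :=
  Matrix.of fun i j =>
    if (i : ℕ) + (j : ℕ) + 3 ≤ n then t ((i : ℤ) + (j : ℤ) + 2)
    else if n + 1 ≤ (i : ℕ) + (j : ℕ) then t (2 * (n : ℤ) - (i : ℤ) - (j : ℤ))
    else 0

/-- The natural tau matrix (diagonalised by the discrete sine transform) of the symmetric
Toeplitz matrix generated by `t`. -/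
def tauMatrix (t : ℤ → ℝ) (n : ℕ) : Matrix (Fin n) (Fin n) ℝ :=
  toeplitz t n - tauHankel t n

/-- The tridiagonal matrix `tridiag (-1, 2, -1)`. -/
def secondDiff (n : ℕ) : Matrix (Fin n) (Fin n) ℝ :=
  Matrix.of fun i j =>
    if i = j then 2
    else if (i : ℕ) + 1 = (j : ℕ) ∨ (j : ℕ) + 1 = (i : ℕ) then -1
    else 0

/-- The matrix `Q_n = I + (α / 24) tridiag (-1, 2, -1)`. -/
def quasiMatrix (α : ℝ) (n : ℕ) : Matrix (Fin n) (Fin n) ℝ :=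
  1 + (α / 24) • secondDiff n

/-- The one-dimensional stiffness matrix `S_n^{(α)}`. -/
def stiffness (α : ℝ) (n : ℕ) : Matrix (Fin n) (Fin n) ℝ :=
  toeplitz (fcd4Coeff α) n

/-- The one-dimensional sine transform based preconditioner `P_α = Q_n τ(Ŝ_n^{(α)})`, where
`Ŝ_n^{(α)}` is the Toeplitz matrix of the second-order fractional centred difference. -/
def precond1D (α : ℝ) (n : ℕ) : Matrix (Fin n) (Fin n) ℝ :=
  quasiMatrix α n * tauMatrix (fcdCoeff α) n

/-- The Kronecker product `A 0 ⊗ A 1 ⊗ ⋯ ⊗ A (d-1)`, with rows and columns indexed by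
multi-indices of the grid. -/
def kroneckerProd {d : ℕ} {n : Fin d → ℕ} (A : ∀ i, Matrix (Fin (n i)) (Fin (n i)) ℝ) :
    Matrix (∀ i, Fin (n i)) (∀ i, Fin (n i)) ℝ :=
  Matrix.of fun J J' => ∏ k, A k (J k) (J' k)

/-- The Kronecker product `I ⊗ ⋯ ⊗ I ⊗ B ⊗ I ⊗ ⋯ ⊗ I` with `B` in position `i`. -/
def kroneckerAt {d : ℕ} {n : Fin d → ℕ} (i : Fin d) (B : Matrix (Fin (n i)) (Fin (n i)) ℝ) :
    Matrix (∀ i, Fin (n i)) (∀ i, Fin (n i)) ℝ :=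
  kroneckerProd (Function.update (fun k => (1 : Matrix (Fin (n k)) (Fin (n k)) ℝ)) i B)

/-- The spatial step sizes `h_i = (b_i - a_i) / (n_i + 1)`. -/
def stepSize {d : ℕ} (a b : Fin d → ℝ) (n : Fin d → ℕ) (i : Fin d) : ℝ :=
  (b i - a i) / ((n i : ℝ) + 1)

/-- The interior grid node with (zero-based) multi-index `J`. -/
def gridPoint {d : ℕ} (a b : Fin d → ℝ) (n : Fin d → ℕ) (J : ∀ i, Fin (n i)) : Fin d → ℝ :=
  fun i => a i + (((J i : ℕ) : ℝ) + 1) * stepSize a b n i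

/-- The open box `∏ i, (a_i, b_i)`. -/
def openBox {d : ℕ} (a b : Fin d → ℝ) : Set (Fin d → ℝ) :=
  Set.univ.pi fun i => Set.Ioo (a i) (b i)

/-- The weights `η_i = K_i Δt / (2 h_i ^ α_i)`. -/
def eta {d : ℕ} (a b α K : Fin d → ℝ) (n : Fin d → ℕ) (Δt : ℝ) (i : Fin d) : ℝ :=
  K i * Δt / (2 * stepSize a b n i ^ α i)

/-- The multilevel Toeplitz matrix `T = ∑ i, η_i I ⊗ S_{n_i}^{(α_i)} ⊗ I`. -/
def matT {d : ℕ} (a b α K : Fin d → ℝ) (n : Fin d → ℕ) (Δt : ℝ) :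
    Matrix (∀ i, Fin (n i)) (∀ i, Fin (n i)) ℝ :=
  ∑ i, eta a b α K n Δt i • kroneckerAt i (stiffness (α i) (n i))

/-- The diagonal matrix of the values of `r (·, t)` at the interior grid nodes. -/
def matD {d : ℕ} (a b : Fin d → ℝ) (n : Fin d → ℕ) (r : (Fin d → ℝ) → ℝ → ℝ) (t : ℝ) :
    Matrix (∀ i, Fin (n i)) (∀ i, Fin (n i)) ℝ :=
  Matrix.diagonal fun J => r (gridPoint a b n J) t

/-- The preconditioner `P_τ = r̄ I + ∑ i, η_i I ⊗ P_{α_i} ⊗ I`. -/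
def precond {d : ℕ} (a b α K : Fin d → ℝ) (n : Fin d → ℕ) (Δt rbar : ℝ) :
    Matrix (∀ i, Fin (n i)) (∀ i, Fin (n i)) ℝ :=
  rbar • (1 : Matrix (∀ i, Fin (n i)) (∀ i, Fin (n i)) ℝ) +
    ∑ i, eta a b α K n Δt i • kroneckerAt i (precond1D (α i) (n i))

/-- Least upper bound of `r (·, t)` on the open box. -/
def rHat {d : ℕ} (a b : Fin d → ℝ) (r : (Fin d → ℝ) → ℝ → ℝ) (t : ℝ) : ℝ :=
  sSup ((fun x => r x t) '' openBox a b)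

/-- Greatest lower bound of `r (·, t)` on the open box. -/
def rCheck {d : ℕ} (a b : Fin d → ℝ) (r : (Fin d → ℝ) → ℝ → ℝ) (t : ℝ) : ℝ :=
  sInf ((fun x => r x t) '' openBox a b)

end RieszFD

end

/-!
All comparisons of matrices are in the Loewner order, which on real symmetric matrices compares
quadratic forms.

For real symmetric `A` and positive definite `P`, the bounds `c • P ≤ A ≤ C • P` place every
eigenvalue of `P⁻¹ * A` in `[c, C]` (`real_bounds_of_hasEigenvalue_inv_mul`). With `A = D + T` and
`P = P_τ` the comparison splits: the diagonal `D` is compared with `r̄ I` entry by entry, and since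
`B ↦ I ⊗ B ⊗ I` is monotone (`kroneckerAt_mono`), `T` is compared with the remaining sum one
direction at a time. It remains to show `3/8 P_α ≤ S_n ≤ 2 P_α` in one dimension, and there the
constants are `3/8 = (1/2) (3/4)` and `2 = (4/3) (3/2)`:

* `Ŝ_n ≤ S_n ≤ 4/3 Ŝ_n`. The symbol of `S_n` is that of `Ŝ_n` times
  `1 + α/24 (2 - 2 cos θ) ∈ [1, 4/3]`. Instead of integral representations the proof uses that
  multiplying a symbol by `2 ∓ 2 cos θ = |1 ∓ e^{iθ}|²` is a congruence from the
  Toeplitz matrix of size `n + 1` (`toeplitz_second_difference_nonneg`).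
* `1/2 τ(Ŝ_n) ≤ Ŝ_n ≤ 3/2 τ(Ŝ_n)`, that is, `Ŝ_n + H_n` and `Ŝ_n - 3 H_n` are positive
  semidefinite. The coefficients `g_k` are even, negative and increasing for `k ≥ 1`, and have
  positive symmetric partial sums; hence `Ŝ_n - c H_n` is strictly diagonally dominant for every
  `c ∈ [-1, 3]` (`IsDominatedStencil.posDef_toeplitz_sub_smul_tauHankel`). For `c = 1` this is
  the positivity of `τ(Ŝ_n)`.
* `τ(Ŝ_n) ≤ P_α ≤ 4/3 τ(Ŝ_n)`. The factor `Q_n = I + α/24 tridiag(-1, 2, -1)` lies between `I` and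
  `4/3 I` and commutes with `τ(Ŝ_n)` (`commute_secondDiff_tauMatrix`), and products of commuting
  positive semidefinite matrices are positive semidefinite.
-/

namespace RieszFD

open Matrix Finset
open scoped MatrixOrder

/-! ### Positivity of real symmetric matrices -/

section Loewner

variable {ι : Type*}

/-- A symmetric strictly diagonally dominant matrix with positive diagonal is positive definite. -/
theorem posDef_of_diagDominant [Fintype ι] [DecidableEq ι] {A : Matrix ι ι ℝ} (hsymm : ∀ i j, A i j = A j i)
    (hdom : ∀ i, ∑ j ∈ univ.erase i, |A i j| < A i i) : A.PosDef := by
  refine .of_dotProduct_mulVec_pos (by ext i j; simpa using hsymm j i) fun x hx => ?_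
  -- the off-diagonal terms are absorbed through `2 |x i * x j| ≤ x i ^ 2 + x j ^ 2`
  have expand : star x ⬝ᵥ A *ᵥ x =
      ∑ i, (A i i * x i ^ 2 + ∑ j ∈ univ.erase i, A i j * (x i * x j)) := by
    simp only [dotProduct, mulVec, mul_sum, star_trivial]
    refine sum_congr rfl fun i _ => ?_
    rw [← add_sum_erase _ _ (mem_univ i)]
    congr 1
    · ring
    · exact sum_congr rfl fun j _ => by ring
  have swap : ∑ i, ∑ j ∈ univ.erase i, |A i j| * x j ^ 2 =
      ∑ i, ∑ j ∈ univ.erase i, |A i j| * x i ^ 2 := by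
    rw [sum_comm' (t' := univ) (s' := fun j => univ.erase j) (by simp [eq_comm])]
    exact sum_congr rfl fun i _ => sum_congr rfl fun j _ => by rw [hsymm]
  have lower : ∑ i, (A i i - ∑ j ∈ univ.erase i, |A i j|) * x i ^ 2 ≤ star x ⬝ᵥ A *ᵥ x := by
    have : ∑ i, (A i i - ∑ j ∈ univ.erase i, |A i j|) * x i ^ 2 =
        ∑ i, (A i i * x i ^ 2 +
          ∑ j ∈ univ.erase i, -(|A i j| * ((x i ^ 2 + x j ^ 2) / 2))) := by
      have e : ∀ i, ∑ j ∈ univ.erase i, -(|A i j| * ((x i ^ 2 + x j ^ 2) / 2)) =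
          -(1 / 2) * ∑ j ∈ univ.erase i, |A i j| * x i ^ 2
            - (1 / 2) * ∑ j ∈ univ.erase i, |A i j| * x j ^ 2 := fun i => by
        rw [mul_sum, mul_sum, ← sum_sub_distrib]
        exact sum_congr rfl fun j _ => by ring
      simp only [e, sum_add_distrib, sum_sub_distrib, sub_mul, ← mul_sum, swap]
      simp only [← sum_mul]
      ring
    rw [this, expand]
    gcongr with i _ j _
    have h := neg_abs_le (A i j * (x i * x j))
    rw [abs_mul] at h
    refine le_trans ?_ h
    have : |x i * x j| ≤ (x i ^ 2 + x j ^ 2) / 2 := by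
      rw [abs_le]
      constructor <;> nlinarith [sq_nonneg (x i + x j), sq_nonneg (x i - x j)]
    have := mul_le_mul_of_nonneg_left this (abs_nonneg (A i j))
    linarith
  refine lt_of_lt_of_le ?_ lower
  obtain ⟨i, hi⟩ := Function.ne_iff.mp hx
  refine sum_pos' (fun i _ => mul_nonneg (sub_nonneg.2 (hdom i).le) (sq_nonneg _))
    ⟨i, mem_univ i, mul_pos (sub_pos.2 (hdom i)) (sq_pos_of_ne_zero hi)⟩

theorem smul_le_smul_loewner {A B : Matrix ι ι ℝ} (h : A ≤ B) {c : ℝ} (hc : 0 ≤ c) :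
    c • A ≤ c • B := by
  rw [le_iff] at h ⊢
  rw [← smul_sub]
  exact h.smul hc

theorem smul_nonneg_loewner {A : Matrix ι ι ℝ} (h : 0 ≤ A) {c : ℝ} (hc : 0 ≤ c) : 0 ≤ c • A := by
  simpa using smul_le_smul_loewner h hc

theorem smul_le_smul_of_le_left {A : Matrix ι ι ℝ} (hA : 0 ≤ A) {c c' : ℝ} (hc : c ≤ c') :
    c • A ≤ c' • A := by
  have := smul_nonneg_loewner hA (sub_nonneg.2 hc)
  rwa [sub_smul, sub_nonneg] at this

/-- If `A *ᵥ v = z • P *ᵥ v` with `P` positive definite, then comparing `vᴴ A v` with its conjugate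
shows that `z` is real; the real or the imaginary part of `v` is then a real eigenvector, whose
Rayleigh quotient lies between the constants of the two-sided comparison. -/
theorem real_bounds_of_hasEigenvalue_inv_mul [Fintype ι] [DecidableEq ι] {A P : Matrix ι ι ℝ} (hP : P.PosDef)
    (hA : A.IsHermitian) {c C : ℝ} (hlo : c • P ≤ A) (hhi : A ≤ C • P) {z : ℂ}
    (hz : Module.End.HasEigenvalue
      (Matrix.toLin' ((P⁻¹ * A).map (fun x : ℝ => (x : ℂ)))) z) :
    ∃ lam : ℝ, z = (lam : ℂ) ∧ c ≤ lam ∧ lam ≤ C := by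
  obtain ⟨v, hv⟩ := hz.exists_hasEigenvector
  set x : ι → ℝ := fun i => (v i).re with hx
  set y : ι → ℝ := fun i => (v i).im with hy
  have hvz := hv.apply_eq_smul
  rw [toLin'_apply] at hvz
  have hre : (P⁻¹ * A) *ᵥ x = z.re • x - z.im • y := by
    ext i
    have := congrArg Complex.re (congrFun hvz i)
    simpa [mulVec, dotProduct, x, y] using this
  have him : (P⁻¹ * A) *ᵥ y = z.re • y + z.im • x := by
    ext i
    have := congrArg Complex.im (congrFun hvz i)
    simpa [mulVec, dotProduct, x, y] using this
  have hdet : IsUnit P.det := (isUnit_iff_isUnit_det P).1 hP.isUnit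
  have key : ∀ u : ι → ℝ, P *ᵥ ((P⁻¹ * A) *ᵥ u) = A *ᵥ u := fun u => by
    rw [mulVec_mulVec, ← mul_assoc, mul_nonsing_inv _ hdet, one_mul]
  have hAx : A *ᵥ x = z.re • P *ᵥ x - z.im • P *ᵥ y := by
    rw [← key, hre, mulVec_sub, mulVec_smul, mulVec_smul]
  have hAy : A *ᵥ y = z.re • P *ᵥ y + z.im • P *ᵥ x := by
    rw [← key, him, mulVec_add, mulVec_smul, mulVec_smul]
  have symm : ∀ {B : Matrix ι ι ℝ}, B.IsHermitian → x ⬝ᵥ B *ᵥ y = y ⬝ᵥ B *ᵥ x := fun {B} hB => by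
    have hB' : Bᵀ = B := by
      rw [← conjTranspose_eq_transpose_of_trivial]; exact hB
    rw [dotProduct_mulVec, ← mulVec_transpose, hB', dotProduct_comm]
  have hxy : x ≠ 0 ∨ y ≠ 0 := by
    by_contra! h
    refine hv.2 (funext fun i => Complex.ext ?_ ?_)
    · exact congrFun h.1 i
    · exact congrFun h.2 i
  have nonneg : ∀ u : ι → ℝ, 0 ≤ u ⬝ᵥ P *ᵥ u := fun u => by
    simpa using hP.posSemidef.dotProduct_mulVec_nonneg u
  have pos : ∀ {u : ι → ℝ}, u ≠ 0 → 0 < u ⬝ᵥ P *ᵥ u := fun {u} hu => by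
    simpa using hP.dotProduct_mulVec_pos hu
  have him0 : z.im = 0 := by
    have h1 := symm hA
    rw [hAx, hAy] at h1
    simp only [dotProduct_add, dotProduct_sub, dotProduct_smul, smul_eq_mul,
      symm hP.isHermitian] at h1
    have h2 : z.im * (x ⬝ᵥ P *ᵥ x + y ⬝ᵥ P *ᵥ y) = 0 := by linarith
    rcases mul_eq_zero.1 h2 with h | h
    · exact h
    · rcases hxy with hx' | hy'
      · linarith [pos hx', nonneg y]
      · linarith [pos hy', nonneg x]
  have real : ∃ u : ι → ℝ, u ≠ 0 ∧ A *ᵥ u = z.re • P *ᵥ u := by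
    rcases hxy with h | h
    · exact ⟨x, h, by simpa [him0] using hAx⟩
    · exact ⟨y, h, by simpa [him0] using hAy⟩
  obtain ⟨u, hu, hAu⟩ := real
  have hq := pos hu
  have h1 := (le_iff.1 hlo).dotProduct_mulVec_nonneg u
  have h2 := (le_iff.1 hhi).dotProduct_mulVec_nonneg u
  simp only [star_trivial, sub_mulVec, smul_mulVec, hAu, dotProduct_sub, dotProduct_smul,
    smul_eq_mul] at h1 h2
  refine ⟨z.re, Complex.ext rfl (by simpa using him0), ?_, ?_⟩
  · exact le_of_mul_le_mul_right (by linarith) hq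
  · exact le_of_mul_le_mul_right (by linarith) hq

end Loewner

/-! ### Kronecker products -/

section Kronecker

variable {d : ℕ} {n : Fin d → ℕ}

theorem kroneckerProd_mul (A B : ∀ i, Matrix (Fin (n i)) (Fin (n i)) ℝ) :
    kroneckerProd A * kroneckerProd B = kroneckerProd fun i => A i * B i := by
  ext J J'
  simp only [kroneckerProd, mul_apply, of_apply, ← prod_mul_distrib]
  rw [prod_univ_sum, Fintype.piFinset_univ]

theorem kroneckerAt_apply (i : Fin d) (B : Matrix (Fin (n i)) (Fin (n i)) ℝ)
    (J J' : ∀ i, Fin (n i)) :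
    kroneckerAt i B J J' =
      B (J i) (J' i) * ∏ k ∈ univ.erase i, (1 : Matrix (Fin (n k)) (Fin (n k)) ℝ) (J k) (J' k) := by
  simp only [kroneckerAt, kroneckerProd, of_apply]
  rw [← mul_prod_erase _ _ (mem_univ i), Function.update_self]
  congr 1
  exact prod_congr rfl fun k hk => by rw [Function.update_of_ne (ne_of_mem_erase hk)]

theorem kroneckerAt_sub (i : Fin d) (B C : Matrix (Fin (n i)) (Fin (n i)) ℝ) :
    kroneckerAt i (B - C) = kroneckerAt i B - kroneckerAt i C := by
  ext J J'
  simp only [kroneckerAt_apply, Matrix.sub_apply, sub_mul]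

theorem kroneckerAt_smul (i : Fin d) (c : ℝ) (B : Matrix (Fin (n i)) (Fin (n i)) ℝ) :
    kroneckerAt i (c • B) = c • kroneckerAt i B := by
  ext J J'
  simp only [kroneckerAt_apply, Matrix.smul_apply, smul_eq_mul, mul_assoc]

theorem kroneckerAt_mul (i : Fin d) (B C : Matrix (Fin (n i)) (Fin (n i)) ℝ) :
    kroneckerAt i (B * C) = kroneckerAt i B * kroneckerAt i C := by
  rw [kroneckerAt, kroneckerAt, kroneckerAt, kroneckerProd_mul]
  congr 1
  funext k
  by_cases h : k = i
  · subst h; simp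
  · simp [h]

theorem kroneckerAt_transpose (i : Fin d) (B : Matrix (Fin (n i)) (Fin (n i)) ℝ) :
    kroneckerAt i Bᵀ = (kroneckerAt i B)ᵀ := by
  ext J J'
  simp only [kroneckerAt_apply, transpose_apply]
  congr 1
  exact prod_congr rfl fun k _ => by simp only [one_apply, eq_comm]

/-- A positive semidefinite `B = Cᵀ * C` yields `I ⊗ B ⊗ I = (I ⊗ C ⊗ I)ᵀ * (I ⊗ C ⊗ I)`. -/
theorem kroneckerAt_nonneg (i : Fin d) {B : Matrix (Fin (n i)) (Fin (n i)) ℝ} (hB : 0 ≤ B) :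
    0 ≤ kroneckerAt i B := by
  obtain ⟨C, rfl⟩ := CStarAlgebra.nonneg_iff_eq_star_mul_self.mp hB
  have hC : star C = Cᵀ := by
    rw [star_eq_conjTranspose, conjTranspose_eq_transpose_of_trivial]
  rw [hC, kroneckerAt_mul, kroneckerAt_transpose, ← conjTranspose_eq_transpose_of_trivial]
  exact (posSemidef_conjTranspose_mul_self _).nonneg

theorem kroneckerAt_mono (i : Fin d) {B C : Matrix (Fin (n i)) (Fin (n i)) ℝ} (h : B ≤ C) :
    kroneckerAt i B ≤ kroneckerAt i C := by
  rw [← sub_nonneg, ← kroneckerAt_sub]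
  exact kroneckerAt_nonneg i (sub_nonneg.2 h)

end Kronecker

/-! ### Coefficients of the fractional centred differences -/

section Coefficients

variable {α : ℝ}

/-- Since `α / 2` is not an integer, the Gamma functions in `fcdCoeff` are never evaluated at a
pole. -/
theorem half_sub_intCast_ne_zero (hα : α ∈ Set.Ioo (1 : ℝ) 2) (k : ℤ) : α / 2 - k ≠ 0 := by
  obtain ⟨h1, h2⟩ := hα
  intro h
  have e1 : (0 : ℝ) < k := by linarith
  have e2 : (k : ℝ) < 1 := by linarith
  norm_cast at e1 e2
  omega

theorem half_add_intCast_ne_zero (hα : α ∈ Set.Ioo (1 : ℝ) 2) (k : ℤ) : α / 2 + k ≠ 0 := by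
  simpa using half_sub_intCast_ne_zero hα (-k)

theorem fcdCoeff_neg (α : ℝ) (k : ℤ) : fcdCoeff α (-k) = fcdCoeff α k := by
  simp only [fcdCoeff, Int.cast_neg, sub_neg_eq_add, ← sub_eq_add_neg]
  rw [mul_comm (Real.Gamma (α / 2 + k + 1)), _root_.zpow_neg, ← _root_.inv_zpow]
  norm_num

theorem fcdCoeff_succ (hα : α ∈ Set.Ioo (1 : ℝ) 2) (k : ℤ) :
    (α / 2 + k + 1) * fcdCoeff α (k + 1) = -(α / 2 - k) * fcdCoeff α k := by
  have h1 : Real.Gamma (α / 2 - k + 1) = (α / 2 - k) * Real.Gamma (α / 2 - k) :=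
    Real.Gamma_add_one (half_sub_intCast_ne_zero hα k)
  have hp : α / 2 + k + 1 ≠ 0 := by
    have := half_add_intCast_ne_zero hα (k + 1); push_cast at this; rwa [← add_assoc] at this
  have h2 : Real.Gamma (α / 2 + k + 1 + 1) = (α / 2 + k + 1) * Real.Gamma (α / 2 + k + 1) :=
    Real.Gamma_add_one hp
  have g1 : Real.Gamma (α / 2 - k) ≠ 0 := Real.Gamma_ne_zero fun m h =>
    half_sub_intCast_ne_zero hα (k - m) (by push_cast; linarith)
  have g2 : Real.Gamma (α / 2 + k + 1) ≠ 0 := Real.Gamma_ne_zero fun m h =>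
    half_add_intCast_ne_zero hα (k + 1 + m) (by push_cast; linarith)
  have hk := half_sub_intCast_ne_zero hα k
  simp only [fcdCoeff, Int.cast_add, Int.cast_one]
  rw [show α / 2 - (k + 1 : ℝ) + 1 = α / 2 - k by ring,
    show α / 2 + (k + 1 : ℝ) + 1 = α / 2 + k + 1 + 1 by ring, h1, h2,
    zpow_add_one₀ (by norm_num)]
  generalize Real.Gamma (α / 2 - k) = X at *
  generalize Real.Gamma (α / 2 + k + 1) = Y at *
  generalize α / 2 - (k : ℝ) = q at *
  generalize α / 2 + (k : ℝ) + 1 = p at *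
  field_simp

theorem fcdCoeff_zero_pos (hα : α ∈ Set.Ioo (1 : ℝ) 2) : 0 < fcdCoeff α 0 := by
  obtain ⟨h1, h2⟩ := hα
  have := Real.Gamma_pos_of_pos (s := α + 1) (by linarith)
  have := Real.Gamma_pos_of_pos (s := α / 2 + 1) (by linarith)
  simp only [fcdCoeff]
  norm_num
  positivity

theorem fcdCoeff_add_one_neg (hα : α ∈ Set.Ioo (1 : ℝ) 2) (k : ℕ) : fcdCoeff α (k + 1) < 0 := by
  induction k with
  | zero =>
    have h := fcdCoeff_succ hα 0
    have h0 := fcdCoeff_zero_pos hα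
    obtain ⟨h1, h2⟩ := hα
    norm_num at h ⊢
    by_contra! hc
    nlinarith [mul_nonneg (by linarith : (0 : ℝ) ≤ α / 2 + 1) hc,
      mul_pos (by linarith : (0 : ℝ) < α / 2) h0]
  | succ k ih =>
    have h := fcdCoeff_succ hα (k + 1)
    obtain ⟨h1, h2⟩ := hα
    have hk : (0 : ℝ) ≤ k := k.cast_nonneg
    push_cast at h ⊢
    by_contra! hc
    nlinarith [mul_nonneg (by linarith : (0 : ℝ) ≤ α / 2 + (k + 1) + 1) hc,
      mul_pos (by linarith : (0 : ℝ) < (k + 1) - α / 2) (neg_pos.2 ih)]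

theorem fcdCoeff_le_succ (hα : α ∈ Set.Ioo (1 : ℝ) 2) (k : ℕ) :
    fcdCoeff α (k + 1) ≤ fcdCoeff α (k + 1 + 1) := by
  have h := fcdCoeff_succ hα (k + 1)
  have ih := fcdCoeff_add_one_neg hα k
  obtain ⟨h1, h2⟩ := hα
  have hk : (0 : ℝ) ≤ k := k.cast_nonneg
  push_cast at h
  by_contra! hc
  nlinarith [mul_pos (by linarith : (0 : ℝ) < α / 2 + (k + 1) + 1) (sub_pos.2 hc),
    mul_pos (by linarith : (0 : ℝ) < α + 1) (neg_pos.2 ih)]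

/-- The symmetric partial sums telescope, because
`α g_k = (α / 2 - k) g_k - (α / 2 - (k - 1)) g_{k-1}`. -/
theorem sum_fcdCoeff (hα : α ∈ Set.Ioo (1 : ℝ) 2) (N : ℕ) :
    fcdCoeff α 0 + 2 * ∑ k ∈ range N, fcdCoeff α (k + 1) =
      2 / α * ((α / 2 - N) * fcdCoeff α N) := by
  have hα0 : α ≠ 0 := by linarith [hα.1]
  induction N with
  | zero => simp; field_simp
  | succ N ih =>
    have h := fcdCoeff_succ hα N
    rw [sum_range_succ, mul_add, ← add_assoc, ih]
    push_cast at h ⊢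
    field_simp
    linarith

theorem fcd4Coeff_eq (hα : α ∈ Set.Ioo (1 : ℝ) 2) (k : ℤ) :
    fcd4Coeff α k = fcdCoeff α k +
      α / 24 * (2 * fcdCoeff α k - 1 * (fcdCoeff α (k - 1) + fcdCoeff α (k + 1))) := by
  have h1 := fcdCoeff_succ hα k
  have h2 := fcdCoeff_succ hα (k - 1)
  have n1 := half_add_intCast_ne_zero hα (k + 1)
  have n2 := half_sub_intCast_ne_zero hα (k - 1)
  push_cast at h2 n1 n2
  rw [sub_add_cancel] at h2
  have n1' : α + 2 * k + 2 ≠ 0 := fun h => n1 (by linarith)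
  have n2' : α - 2 * k + 2 ≠ 0 := fun h => n2 (by linarith)
  have e1 : fcdCoeff α (k + 1) = -((α - 2 * k) / (α + 2 * k + 2)) * fcdCoeff α k := by
    field_simp
    linarith
  have e2 : fcdCoeff α (k - 1) = -((α + 2 * k) / (α - 2 * k + 2)) * fcdCoeff α k := by
    field_simp
    linarith
  rw [e1, e2]
  change fcdCoeff α k * _ = _
  field_simp
  ring

end Coefficients

/-! ### Toeplitz and tau matrices of a dominated stencil -/

/-- The properties of the coefficients of the fractional centred difference behind the spectral
bounds: they are even, nonpositive and increasing away from `0`, and their symmetric partial sums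
are positive. -/
structure IsDominatedStencil (t : ℤ → ℝ) : Prop where
  neg : ∀ k, t (-k) = t k
  nonpos : ∀ k : ℕ, t (k + 1) ≤ 0
  le_succ : ∀ k : ℕ, t (k + 1) ≤ t (k + 1 + 1)
  sum_pos : ∀ N : ℕ, 0 < t 0 + 2 * ∑ k ∈ range N, t (k + 1)

theorem isDominatedStencil_fcdCoeff {α : ℝ} (hα : α ∈ Set.Ioo (1 : ℝ) 2) :
    IsDominatedStencil (fcdCoeff α) where
  neg := fcdCoeff_neg α
  nonpos k := (fcdCoeff_add_one_neg hα k).le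
  le_succ := fcdCoeff_le_succ hα
  sum_pos N := by
    rw [sum_fcdCoeff hα]
    have hα0 : 0 < α := by linarith [hα.1]
    refine mul_pos (by positivity) ?_
    cases N with
    | zero => have := fcdCoeff_zero_pos hα; norm_num; positivity
    | succ N =>
      push_cast
      refine mul_pos_of_neg_of_neg ?_ (fcdCoeff_add_one_neg hα N)
      have : (0 : ℝ) ≤ N := N.cast_nonneg
      linarith [hα.2]

namespace IsDominatedStencil

variable {t : ℤ → ℝ}

theorem apply_abs (ht : IsDominatedStencil t) (k : ℤ) : t |k| = t k := by
  rcases abs_choice k with h | h <;> rw [h]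
  exact ht.neg k

theorem apply_nonpos (ht : IsDominatedStencil t) {k : ℤ} (hk : k ≠ 0) : t k ≤ 0 := by
  rw [← ht.apply_abs]
  obtain ⟨m, hm⟩ : ∃ m : ℕ, |k| = m + 1 := ⟨(|k| - 1).toNat, by have := abs_pos.2 hk; omega⟩
  rw [hm]
  exact ht.nonpos m

theorem mono (ht : IsDominatedStencil t) {k l : ℤ} (hk : k ≠ 0) (hkl : |k| ≤ |l|) :
    t k ≤ t l := by
  rw [← ht.apply_abs k, ← ht.apply_abs l]
  obtain ⟨m, hm⟩ : ∃ m : ℕ, |k| = m + 1 := ⟨(|k| - 1).toNat, by have := abs_pos.2 hk; omega⟩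
  obtain ⟨p, hp⟩ : ∃ p : ℕ, |l| = m + p + 1 := ⟨(|l| - |k|).toNat, by omega⟩
  rw [hm, hp]
  clear hm hp
  induction p with
  | zero => simp
  | succ p ih =>
    refine ih.trans ?_
    have := ht.le_succ (m + p)
    push_cast at this ⊢
    simpa [add_assoc] using this

end IsDominatedStencil

theorem tauHankel_symm (t : ℤ → ℝ) (n : ℕ) (i j : Fin n) :
    tauHankel t n i j = tauHankel t n j i := by
  simp only [tauHankel, of_apply, add_comm (j : ℕ) (i : ℕ), add_comm (j : ℤ) (i : ℤ),
    sub_right_comm (2 * (n : ℤ)) (j : ℤ) (i : ℤ)]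

/-- The coefficients with `|k| < n`; only these enter the `n × n` matrices. -/
def truncCoeff (t : ℤ → ℝ) (n : ℕ) (k : ℤ) : ℝ := if |k| < n then t k else 0

theorem toeplitz_eq_truncCoeff (t : ℤ → ℝ) (n : ℕ) (i j : Fin n) :
    toeplitz t n i j = truncCoeff t n (i - j) := by
  rw [toeplitz, of_apply, truncCoeff, if_pos]
  rw [abs_lt]
  omega

/-- At most one of the two terms is nonzero. -/
theorem tauHankel_eq_truncCoeff (t : ℤ → ℝ) (n : ℕ) (i j : Fin n) :
    tauHankel t n i j = truncCoeff t n (i + j + 2) + truncCoeff t n (2 * n - i - j) := by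
  have hi := i.2
  have hj := j.2
  simp only [tauHankel, of_apply, truncCoeff, abs_lt]
  split_ifs <;> first | omega | simp

theorem toeplitz_sub (s t : ℤ → ℝ) (n : ℕ) :
    toeplitz s n - toeplitz t n = toeplitz (fun k => s k - t k) n := rfl

theorem toeplitz_smul (c : ℝ) (t : ℤ → ℝ) (n : ℕ) :
    c • toeplitz t n = toeplitz (fun k => c * t k) n := rfl

/-- Multiplying the symbol by `2 - 2 ε cos θ`, `ε = ± 1`, preserves positivity of the Toeplitz
matrices: the new matrix is `Eᵀ * toeplitz t (n + 1) * E` with `E` the bidiagonal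
`(n + 1) × n` matrix of `1 - ε ω`. -/
theorem toeplitz_second_difference_nonneg {t : ℤ → ℝ} {n : ℕ} (ht : 0 ≤ toeplitz t (n + 1))
    {ε : ℝ} (hε : ε * ε = 1) :
    0 ≤ toeplitz (fun k => 2 * t k - ε * (t (k - 1) + t (k + 1))) n := by
  let E : Matrix (Fin (n + 1)) (Fin n) ℝ := of fun i j =>
    (if i = j.castSucc then 1 else 0) - if i = j.succ then ε else 0
  have h := ((nonneg_iff_posSemidef.1 ht).conjTranspose_mul_mul_same E).nonneg
  convert h using 1
  rw [conjTranspose_eq_transpose_of_trivial]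
  ext i j
  simp only [mul_apply, transpose_apply, E, of_apply, sub_mul, mul_sub, ite_mul, mul_ite,
    one_mul, mul_one, zero_mul, mul_zero, sum_sub_distrib, sum_ite_eq', mem_univ, if_true]
  simp only [toeplitz, of_apply, Fin.val_castSucc, Fin.val_succ]
  push_cast
  rw [show ((i : ℤ) + 1 - (j + 1)) = i - j by ring, show ((i : ℤ) + 1 - j) = i - j + 1 by ring,
    show ((i : ℤ) - (j + 1)) = i - j - 1 by ring]
  linear_combination (-t (i - j)) * hε

theorem toeplitz_delta (n : ℕ) : toeplitz (fun k => if k = 0 then 1 else 0) n = 1 := by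
  ext i j
  simp only [toeplitz, of_apply, one_apply, Fin.ext_iff]
  congr 1
  simp only [eq_iff_iff]
  omega

theorem toeplitz_delta_nonneg (n : ℕ) :
    0 ≤ toeplitz (fun k => if k = 0 then 1 else 0) n := by
  rw [toeplitz_delta]
  exact PosSemidef.one.nonneg

theorem secondDiff_nonneg (n : ℕ) : 0 ≤ secondDiff n := by
  convert toeplitz_second_difference_nonneg (toeplitz_delta_nonneg (n + 1)) (ε := 1) (by norm_num)
    using 1
  ext i j
  simp only [secondDiff, toeplitz, of_apply, Fin.ext_iff]
  split_ifs <;> first | omega | norm_num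

theorem secondDiff_le_four (n : ℕ) : secondDiff n ≤ (4 : ℝ) • 1 := by
  rw [← sub_nonneg]
  convert toeplitz_second_difference_nonneg (toeplitz_delta_nonneg (n + 1)) (ε := -1) (by norm_num)
    using 1
  ext i j
  simp only [secondDiff, toeplitz, Matrix.sub_apply, Matrix.smul_apply, one_apply, of_apply,
    Fin.ext_iff]
  split_ifs <;> first | omega | norm_num

/-- With one-based indices, the values of `p - q`, `p + q` and `p + q - (2 n + 2)` for
`1 ≤ q ≤ n` are pairwise distinct, so an even function summed over all of them takes each value
`w k`, `0 < k < n`, at most twice. -/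
theorem row_sum_le {n : ℕ} {w : ℤ → ℝ} (hneg : ∀ k, w (-k) = w k) (hw : ∀ k, 0 ≤ w k)
    (h0 : w 0 = 0) (hsupp : ∀ k : ℤ, n ≤ |k| → w k = 0) (i : Fin n) :
    ∑ j : Fin n, w (i - j) + ∑ j : Fin n, (w (i + j + 2) + w (2 * n - i - j)) ≤
      2 * ∑ k ∈ range (n - 1), w (k + 1) := by
  let f : Fin n ⊕ Fin n ⊕ Fin n → ℤ :=
    Sum.elim (fun j => i - j) (Sum.elim (fun j => i + j + 2) fun j => i + j - 2 * n)
  have hf : Function.Injective f := by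
    have hi := i.2
    rintro (a | a | a) (b | b | b) h <;> simp only [f, Sum.elim_inl, Sum.elim_inr] at h <;>
      (congr; omega)
  have hL : ∑ j : Fin n, w (i - j) + ∑ j : Fin n, (w (i + j + 2) + w (2 * n - i - j)) =
      ∑ k ∈ univ.map ⟨f, hf⟩, w k := by
    rw [sum_map]
    simp only [Function.Embedding.coeFn_mk, Fintype.sum_sum_type, f, Sum.elim_inl, Sum.elim_inr]
    rw [sum_add_distrib]
    congr 2
    exact sum_congr rfl fun j _ => by rw [← hneg]; congr 1; ring
  have hR : 2 * ∑ k ∈ range (n - 1), w (k + 1) =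
      ∑ k ∈ (range (n - 1)).image (fun k : ℕ => (k : ℤ) + 1) ∪
        (range (n - 1)).image (fun k : ℕ => -((k : ℤ) + 1)), w k := by
    rw [sum_union, sum_image, sum_image]
    · simp only [hneg]
      ring
    · intro a _ b _ h
      simpa using h
    · intro a _ b _ h
      simpa using h
    · rw [disjoint_left]
      intro k hk hk'
      simp only [mem_image] at hk hk'
      obtain ⟨a, -, ha⟩ := hk
      obtain ⟨b, -, hb⟩ := hk'
      omega
  rw [hL, hR, ← sum_filter_ne_zero]
  refine sum_le_sum_of_subset_of_nonneg (fun k hk => ?_) fun k _ _ => hw k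
  have hk0 : w k ≠ 0 := (mem_filter.1 hk).2
  have hkn : |k| < n := not_le.1 fun h => hk0 (hsupp k h)
  have hk1 : k ≠ 0 := fun h => hk0 (h ▸ h0)
  rw [abs_lt] at hkn
  simp only [mem_union, mem_image, mem_range]
  rcases lt_or_gt_of_ne hk1 with h | h
  · exact Or.inr ⟨(-k - 1).toNat, by omega, by omega⟩
  · exact Or.inl ⟨(k - 1).toNat, by omega, by omega⟩

namespace IsDominatedStencil

variable {t : ℤ → ℝ} {n : ℕ}

theorem tauHankel_nonpos (ht : IsDominatedStencil t) (i j : Fin n) : tauHankel t n i j ≤ 0 := by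
  simp only [tauHankel, of_apply]
  split_ifs
  · exact ht.apply_nonpos (by omega)
  · exact ht.apply_nonpos (by omega)
  · exact le_rfl

theorem le_tauHankel (ht : IsDominatedStencil t) {i j : Fin n} (hij : i ≠ j) :
    t (i - j) ≤ tauHankel t n i j := by
  have hij' : (i : ℤ) - j ≠ 0 := fun h => hij (Fin.ext (by omega))
  simp only [tauHankel, of_apply]
  split_ifs
  · exact ht.mono hij' (by rw [abs_of_nonneg (a := (i : ℤ) + j + 2) (by omega), abs_le]; omega)
  · exact ht.mono hij'
      (by rw [abs_of_nonneg (a := 2 * (n : ℤ) - i - j) (by omega), abs_le]; omega)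
  · exact ht.apply_nonpos hij'

/-- A whole row of `toeplitz t n + tauHankel t n` has positive sum. -/
theorem row_sum_pos (ht : IsDominatedStencil t) (i : Fin n) :
    0 < t 0 + ∑ j ∈ univ.erase i, t (i - j) + ∑ j, tauHankel t n i j := by
  let w : ℤ → ℝ := fun k => if k = 0 then 0 else -truncCoeff t n k
  have hw0 : w 0 = 0 := if_pos rfl
  have hw : ∀ {k}, k ≠ 0 → w k = -truncCoeff t n k := fun hk => if_neg hk
  have h := row_sum_le (n := n) (w := w) (fun k => by
      simp only [w, neg_eq_zero, truncCoeff, abs_neg, ht.neg]) (fun k => by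
      by_cases hk : k = 0
      · simp [w, hk]
      · rw [hw hk, truncCoeff]
        split_ifs
        · exact neg_nonneg.2 (ht.apply_nonpos hk)
        · simp) hw0 (fun k hk => by
      simp [w, truncCoeff, not_lt.2 hk]) i
  have e1 : ∑ j : Fin n, w (i - j) = -∑ j ∈ univ.erase i, t (i - j) := by
    rw [← add_sum_erase _ _ (mem_univ i), sub_self, hw0, zero_add, ← sum_neg_distrib]
    refine sum_congr rfl fun j hj => ?_
    have hj' : (i : ℤ) - j ≠ 0 := fun h => ne_of_mem_erase hj (Fin.ext (by omega))
    rw [hw hj', ← toeplitz_eq_truncCoeff]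
    rfl
  have e2 : ∑ j : Fin n, (w (i + j + 2) + w (2 * n - i - j)) = -∑ j, tauHankel t n i j := by
    rw [← sum_neg_distrib]
    refine sum_congr rfl fun j _ => ?_
    rw [hw (by omega), hw (by omega), tauHankel_eq_truncCoeff]
    ring
  have e3 : ∑ k ∈ range (n - 1), w (k + 1) = -∑ k ∈ range (n - 1), t (k + 1) := by
    rw [← sum_neg_distrib]
    refine sum_congr rfl fun k hk => ?_
    rw [mem_range] at hk
    rw [hw (by omega), truncCoeff, if_pos]
    rw [abs_of_nonneg (by omega)]
    omega
  rw [e1, e2, e3] at h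
  linarith [ht.sum_pos (n - 1)]

/-- Off the diagonal `t (i - j) ≤ tauHankel t n i j ≤ 0`, which gives
`|t (i - j) - c * tauHankel t n i j| ≤ -t (i - j) - tauHankel t n i j` for `c` in
`[-1, 3]`, so the rows are strictly diagonally dominant. -/
theorem posDef_toeplitz_sub_smul_tauHankel (ht : IsDominatedStencil t) {c : ℝ} (hc : -1 ≤ c)
    (hc' : c ≤ 3) : (toeplitz t n - c • tauHankel t n).PosDef := by
  refine posDef_of_diagDominant (fun i j => ?_) fun i => ?_
  · simp only [Matrix.sub_apply, Matrix.smul_apply, tauHankel_symm t n i j, toeplitz, of_apply]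
    rw [← ht.neg, neg_sub]
  · have hoff : ∑ j ∈ univ.erase i, |(toeplitz t n - c • tauHankel t n) i j| ≤
        ∑ j ∈ univ.erase i, (-t (i - j) - tauHankel t n i j) := by
      refine sum_le_sum fun j hj => ?_
      have h1 := ht.tauHankel_nonpos i j
      have h2 := ht.le_tauHankel (ne_of_mem_erase hj).symm
      change |t (i - j) - c * tauHankel t n i j| ≤ _
      rw [abs_le]
      constructor <;> nlinarith
    have hrow := ht.row_sum_pos i
    have h1 := ht.tauHankel_nonpos i i
    have hdiag : t 0 + tauHankel t n i i ≤ (toeplitz t n - c • tauHankel t n) i i := by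
      simp only [Matrix.sub_apply, Matrix.smul_apply, toeplitz, of_apply, sub_self, smul_eq_mul]
      nlinarith
    rw [← add_sum_erase _ _ (mem_univ i)] at hrow
    simp only [sum_sub_distrib, sum_neg_distrib] at hoff
    linarith

theorem toeplitz_nonneg (ht : IsDominatedStencil t) : 0 ≤ toeplitz t n := by
  simpa using (ht.posDef_toeplitz_sub_smul_tauHankel (n := n) (c := 0)
    (by norm_num) (by norm_num)).posSemidef.nonneg

theorem tauMatrix_posDef (ht : IsDominatedStencil t) : (tauMatrix t n).PosDef := by
  simpa [tauMatrix] using ht.posDef_toeplitz_sub_smul_tauHankel (n := n) (c := 1)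
    (by norm_num) (by norm_num)

theorem half_tauMatrix_le_toeplitz (ht : IsDominatedStencil t) :
    (1 / 2 : ℝ) • tauMatrix t n ≤ toeplitz t n := by
  have h := smul_nonneg_loewner (ht.posDef_toeplitz_sub_smul_tauHankel (n := n) (c := -1)
    (by norm_num) (by norm_num)).posSemidef.nonneg (c := 1 / 2) (by norm_num)
  rw [← sub_nonneg]
  convert h using 1
  rw [tauMatrix]
  module

theorem toeplitz_le_three_halves_tauMatrix (ht : IsDominatedStencil t) :
    toeplitz t n ≤ (3 / 2 : ℝ) • tauMatrix t n := by
  have h := smul_nonneg_loewner (ht.posDef_toeplitz_sub_smul_tauHankel (n := n) (c := 3)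
    (by norm_num) (by norm_num)).posSemidef.nonneg (c := 1 / 2) (by norm_num)
  rw [← sub_nonneg]
  convert h using 1
  rw [tauMatrix]
  module

end IsDominatedStencil

/-- `secondDiff n` acts as minus the discrete Laplacian on grid functions with zero boundary
values at `0` and `n + 1`. -/
theorem sum_secondDiff_mul {n : ℕ} (f : ℤ → ℝ) (h0 : f 0 = 0) (hn : f (n + 1) = 0) (i : Fin n) :
    ∑ k, secondDiff n i k * f (k + 1) = 2 * f (i + 1) - f i - f (i + 2) := by
  have split : ∀ k : Fin n, secondDiff n i k * f (k + 1) =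
      (if k = i then 2 * f (i + 1) else 0) - (if (k : ℕ) + 1 = i then f i else 0) -
        (if (k : ℕ) = i + 1 then f (i + 2) else 0) := by
    intro k
    simp only [secondDiff, of_apply, Fin.ext_iff]
    split_ifs <;> first
      | omega
      | (rw [show (k : ℤ) + 1 = i + 1 by omega]; ring)
      | (rw [show (k : ℤ) + 1 = i by omega]; ring)
      | (rw [show (k : ℤ) + 1 = i + 2 by omega]; ring)
      | ring
  simp only [split, sum_sub_distrib, sum_ite_eq', mem_univ, if_true]
  congr 1
  · congr 1
    rcases Nat.eq_zero_or_pos (i : ℕ) with h | h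
    · simp [h, h0]
    · rw [sum_eq_single (⟨i - 1, by omega⟩ : Fin n)]
      · rw [if_pos]; simp only; omega
      · intro k _ hk
        rw [if_neg]
        intro h'
        exact hk (Fin.ext (by simp only; omega))
      · simp
  · by_cases h : (i : ℕ) + 1 < n
    · rw [sum_eq_single (⟨i + 1, h⟩ : Fin n)]
      · simp
      · intro k _ hk
        rw [if_neg]
        intro h'
        exact hk (Fin.ext h')
      · simp
    · rw [show (i : ℤ) + 2 = n + 1 by omega, hn]
      simp

theorem secondDiff_symm (n : ℕ) (i j : Fin n) : secondDiff n i j = secondDiff n j i := by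
  simp only [secondDiff, of_apply, Fin.ext_iff, eq_comm (a := (i : ℕ)), or_comm]

/-- With one-based indices the tau matrix is the restriction of
`F p q = t (p - q) - t (p + q) - t (2 n + 2 - p - q)`, which vanishes for `p` or `q` in
`{0, n + 1}` and satisfies `F (p - 1) q + F (p + 1) q = F p (q - 1) + F p (q + 1)`. -/
theorem commute_secondDiff_tauMatrix {t : ℤ → ℝ} (ht : ∀ k, t (-k) = t k) (n : ℕ) :
    Commute (secondDiff n) (tauMatrix t n) := by
  let u := truncCoeff t n
  have hneg : ∀ k, u (-k) = u k := fun k => by simp only [u, truncCoeff, abs_neg, ht]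
  have hzero : ∀ k : ℤ, n ≤ k → u k = 0 := fun k hk => by
    simp only [u, truncCoeff]
    rw [if_neg (by rw [abs_of_nonneg (by omega)]; omega)]
  let F : ℤ → ℤ → ℝ := fun p q => u (p - q) - u (p + q) - u (2 * n + 2 - p - q)
  have hF : ∀ i j : Fin n, tauMatrix t n i j = F (i + 1) (j + 1) := fun i j => by
    simp only [tauMatrix, Matrix.sub_apply, toeplitz_eq_truncCoeff, tauHankel_eq_truncCoeff, F, u]
    rw [show ((i : ℤ) + 1 - (j + 1)) = i - j by ring,
      show ((i : ℤ) + 1 + (j + 1)) = i + j + 2 by ring,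
      show (2 * (n : ℤ) + 2 - (i + 1) - (j + 1)) = 2 * n - i - j by ring]
    ring
  have hsymm : ∀ p q, F p q = F q p := fun p q => by
    simp only [F, ← hneg (p - q)]
    rw [neg_sub, add_comm p q, sub_right_comm (2 * (n : ℤ) + 2) p q]
  have hleft : ∀ j : Fin n, F 0 (j + 1) = 0 := fun j => by
    simp only [F]
    rw [zero_sub, hneg, zero_add, hzero (2 * n + 2 - 0 - (j + 1)) (by omega)]
    ring
  have hright : ∀ j : Fin n, F (n + 1) (j + 1) = 0 := fun j => by
    simp only [F]
    rw [hzero (n + 1 + (j + 1)) (by omega),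
      show (2 * (n : ℤ) + 2 - (n + 1) - (j + 1)) = n + 1 - (j + 1) by ring]
    ring
  ext i j
  have e1 := sum_secondDiff_mul (fun p => F p (j + 1)) (hleft j) (hright j) i
  have e2 := sum_secondDiff_mul (fun q => F (i + 1) q) (by simp only [hsymm _ 0, hleft])
    (by simp only [hsymm _ (n + 1 : ℤ), hright]) j
  simp only [mul_apply, hF]
  rw [e1, sum_congr rfl fun k _ => by rw [mul_comm, secondDiff_symm], e2]
  simp only [F]
  ring_nf

/-! ### The one-dimensional comparison -/

section OneDimensional

variable {α : ℝ}

/-- The symbol of the difference is `α / 24 * (2 - 2 cos θ)` times that of the second-order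
matrix. -/
theorem toeplitz_le_stiffness (hα : α ∈ Set.Ioo (1 : ℝ) 2) (n : ℕ) :
    toeplitz (fcdCoeff α) n ≤ stiffness α n := by
  have h := smul_nonneg_loewner (toeplitz_second_difference_nonneg
    ((isDominatedStencil_fcdCoeff hα).toeplitz_nonneg (n := n + 1)) (ε := 1) (by norm_num))
    (c := α / 24) (by linarith [hα.1])
  rw [← sub_nonneg]
  convert h using 1
  rw [stiffness, toeplitz_sub, toeplitz_smul]
  congr 1
  funext k
  rw [fcd4Coeff_eq hα]
  ring

/-- The symbol of the difference is `1 / 3 - α / 6 + α / 24 * (2 + 2 cos θ)` times that of the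
second-order matrix. -/
theorem stiffness_le_toeplitz (hα : α ∈ Set.Ioo (1 : ℝ) 2) (n : ℕ) :
    stiffness α n ≤ (4 / 3 : ℝ) • toeplitz (fcdCoeff α) n := by
  have ht := isDominatedStencil_fcdCoeff hα
  have h1 := smul_nonneg_loewner (toeplitz_second_difference_nonneg
    (ht.toeplitz_nonneg (n := n + 1)) (ε := -1) (by norm_num))
    (c := α / 24) (by linarith [hα.1])
  have h2 := smul_nonneg_loewner (ht.toeplitz_nonneg (n := n)) (c := 1 / 3 - α / 6)
    (by linarith [hα.2])
  rw [← sub_nonneg]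
  convert add_nonneg h1 h2 using 1
  ext i j
  simp only [stiffness, toeplitz, Matrix.sub_apply, Matrix.add_apply, Matrix.smul_apply, of_apply,
    smul_eq_mul, fcd4Coeff_eq hα]
  ring

theorem precond1D_eq (α : ℝ) (n : ℕ) :
    precond1D α n = tauMatrix (fcdCoeff α) n +
      (α / 24) • (secondDiff n * tauMatrix (fcdCoeff α) n) := by
  rw [precond1D, quasiMatrix, add_mul, one_mul, smul_mul_assoc]

theorem tauMatrix_le_precond1D (hα : α ∈ Set.Ioo (1 : ℝ) 2) (n : ℕ) :
    tauMatrix (fcdCoeff α) n ≤ precond1D α n := by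
  have ht := isDominatedStencil_fcdCoeff hα
  have h := (commute_secondDiff_tauMatrix ht.neg n).mul_nonneg (secondDiff_nonneg n)
    ht.tauMatrix_posDef.posSemidef.nonneg
  rw [precond1D_eq]
  exact le_add_of_nonneg_right (smul_nonneg_loewner h (by linarith [hα.1]))

theorem precond1D_le_tauMatrix (hα : α ∈ Set.Ioo (1 : ℝ) 2) (n : ℕ) :
    precond1D α n ≤ (4 / 3 : ℝ) • tauMatrix (fcdCoeff α) n := by
  have ht := isDominatedStencil_fcdCoeff hα
  have hτ : 0 ≤ tauMatrix (fcdCoeff α) n := ht.tauMatrix_posDef.posSemidef.nonneg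
  have hc : Commute ((4 : ℝ) • 1 - secondDiff n) (tauMatrix (fcdCoeff α) n) :=
    ((Commute.one_left _).smul_left _).sub_left (commute_secondDiff_tauMatrix ht.neg n)
  have h := smul_nonneg_loewner (hc.mul_nonneg (sub_nonneg.2 (secondDiff_le_four n)) hτ)
    (c := α / 24) (by linarith [hα.1])
  have h' := smul_nonneg_loewner hτ (c := 1 / 3 - α / 6) (by linarith [hα.2])
  rw [← sub_nonneg]
  convert add_nonneg h h' using 1
  rw [precond1D_eq, sub_mul, smul_mul_assoc, one_mul]
  module

theorem precond1D_nonneg (hα : α ∈ Set.Ioo (1 : ℝ) 2) (n : ℕ) : 0 ≤ precond1D α n :=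
  (isDominatedStencil_fcdCoeff hα).tauMatrix_posDef.posSemidef.nonneg.trans
    (tauMatrix_le_precond1D hα n)

theorem precond1D_le_stiffness (hα : α ∈ Set.Ioo (1 : ℝ) 2) (n : ℕ) :
    (3 / 8 : ℝ) • precond1D α n ≤ stiffness α n :=
  calc (3 / 8 : ℝ) • precond1D α n
      ≤ (3 / 8 : ℝ) • (4 / 3 : ℝ) • tauMatrix (fcdCoeff α) n :=
        smul_le_smul_loewner (precond1D_le_tauMatrix hα n) (by norm_num)
    _ = (1 / 2 : ℝ) • tauMatrix (fcdCoeff α) n := by module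
    _ ≤ toeplitz (fcdCoeff α) n := (isDominatedStencil_fcdCoeff hα).half_tauMatrix_le_toeplitz
    _ ≤ stiffness α n := toeplitz_le_stiffness hα n

theorem stiffness_le_precond1D (hα : α ∈ Set.Ioo (1 : ℝ) 2) (n : ℕ) :
    stiffness α n ≤ (2 : ℝ) • precond1D α n :=
  calc stiffness α n
      ≤ (4 / 3 : ℝ) • toeplitz (fcdCoeff α) n := stiffness_le_toeplitz hα n
    _ ≤ (4 / 3 : ℝ) • (3 / 2 : ℝ) • tauMatrix (fcdCoeff α) n :=
        smul_le_smul_loewner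
          (isDominatedStencil_fcdCoeff hα).toeplitz_le_three_halves_tauMatrix (by norm_num)
    _ = (2 : ℝ) • tauMatrix (fcdCoeff α) n := by module
    _ ≤ (2 : ℝ) • precond1D α n :=
        smul_le_smul_loewner (tauMatrix_le_precond1D hα n) (by norm_num)

end OneDimensional

/-! ### The multilevel comparison -/

section Multilevel

variable {d : ℕ} {a b : Fin d → ℝ}

theorem gridPoint_mem_openBox (hab : ∀ i, a i < b i) (n : Fin d → ℕ) (J : ∀ i, Fin (n i)) :
    gridPoint a b n J ∈ openBox a b := by
  intro i _
  have hn : (0 : ℝ) < n i + 1 := by positivity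
  have hpos : 0 < b i - a i := sub_pos.2 (hab i)
  have hJ : ((J i : ℕ) : ℝ) + 1 < n i + 1 := by
    have := (J i).2
    exact_mod_cast Nat.succ_lt_succ this
  simp only [gridPoint, stepSize, Set.mem_Ioo]
  constructor
  · have : 0 < (((J i : ℕ) : ℝ) + 1) * ((b i - a i) / (n i + 1)) := by positivity
    linarith
  · have : (((J i : ℕ) : ℝ) + 1) * ((b i - a i) / (n i + 1)) < b i - a i := by
      rw [mul_div_assoc', div_lt_iff₀ hn, mul_comm]
      exact mul_lt_mul_of_pos_left hJ hpos
    linarith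

theorem openBox_nonempty (hab : ∀ i, a i < b i) : (openBox a b).Nonempty :=
  Set.univ_pi_nonempty_iff.2 fun i => Set.nonempty_Ioo.2 (hab i)

/-- The comparison of `D + T` with `P_τ = r̄ I + ∑ i, η_i I ⊗ P_i ⊗ I` splits into the scalar
comparison of `D` with `r̄ I` and the one-dimensional comparisons. -/
theorem precond_posDef_and_bounds {α K : Fin d → ℝ} {n : Fin d → ℕ} {Δt rbar lo hi t : ℝ}
    {r : (Fin d → ℝ) → ℝ → ℝ} (hα : ∀ i, α i ∈ Set.Ioo (1 : ℝ) 2)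
    (hη : ∀ i, 0 ≤ eta a b α K n Δt i) (hlo : 0 < lo)
    (hr : ∀ J : ∀ i, Fin (n i), lo ≤ r (gridPoint a b n J) t ∧ r (gridPoint a b n J) t ≤ hi)
    (hrbar : rbar ∈ Set.Icc lo hi) :
    (precond a b α K n Δt rbar).PosDef ∧
      (matD a b n r t + matT a b α K n Δt).IsHermitian ∧
      min (lo / hi) (3 / 8) • precond a b α K n Δt rbar ≤
        matD a b n r t + matT a b α K n Δt ∧
      matD a b n r t + matT a b α K n Δt ≤ max (hi / lo) 2 • precond a b α K n Δt rbar := by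
  have hbar : 0 < rbar := hlo.trans_le hrbar.1
  have hhi : 0 < hi := hbar.trans_le hrbar.2
  let B : Matrix (∀ i, Fin (n i)) (∀ i, Fin (n i)) ℝ :=
    ∑ i, eta a b α K n Δt i • kroneckerAt i (precond1D (α i) (n i))
  have hB : 0 ≤ B := sum_nonneg fun i _ =>
    smul_nonneg_loewner (kroneckerAt_nonneg i (precond1D_nonneg (hα i) _)) (hη i)
  have hP : precond a b α K n Δt rbar = rbar • 1 + B := rfl
  have hPD : (precond a b α K n Δt rbar).PosDef := by
    rw [hP]
    exact (PosDef.one.smul hbar).add_posSemidef (nonneg_iff_posSemidef.1 hB)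
  have hTlo : (3 / 8 : ℝ) • B ≤ matT a b α K n Δt := by
    rw [smul_sum, matT]
    refine sum_le_sum fun i _ => ?_
    rw [smul_comm, ← kroneckerAt_smul]
    exact smul_le_smul_loewner (kroneckerAt_mono i (precond1D_le_stiffness (hα i) _)) (hη i)
  have hThi : matT a b α K n Δt ≤ (2 : ℝ) • B := by
    rw [smul_sum, matT]
    refine sum_le_sum fun i _ => ?_
    rw [smul_comm, ← kroneckerAt_smul i (2 : ℝ)]
    exact smul_le_smul_loewner (kroneckerAt_mono i (stiffness_le_precond1D (hα i) _)) (hη i)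
  have hDlo : (lo / hi) • rbar • (1 : Matrix (∀ i, Fin (n i)) (∀ i, Fin (n i)) ℝ) ≤
      matD a b n r t := by
    rw [← sub_nonneg, smul_smul, matD, smul_one_eq_diagonal, diagonal_sub]
    refine (PosSemidef.diagonal fun J => sub_nonneg.2 ?_).nonneg
    refine le_trans ?_ (hr J).1
    rw [div_mul_eq_mul_div, div_le_iff₀ hhi]
    exact mul_le_mul_of_nonneg_left hrbar.2 hlo.le
  have hDhi : matD a b n r t ≤
      (hi / lo) • rbar • (1 : Matrix (∀ i, Fin (n i)) (∀ i, Fin (n i)) ℝ) := by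
    rw [← sub_nonneg, smul_smul, matD, smul_one_eq_diagonal, diagonal_sub]
    refine (PosSemidef.diagonal fun J => sub_nonneg.2 ?_).nonneg
    refine (hr J).2.trans ?_
    rw [div_mul_eq_mul_div, le_div_iff₀ hlo]
    exact mul_le_mul_of_nonneg_left hrbar.1 hhi.le
  have hI : 0 ≤ rbar • (1 : Matrix (∀ i, Fin (n i)) (∀ i, Fin (n i)) ℝ) :=
    (PosSemidef.one.smul hbar.le).nonneg
  have hDlo' : min (lo / hi) (3 / 8) • rbar • 1 ≤ matD a b n r t :=
    (smul_le_smul_of_le_left hI (min_le_left _ _)).trans hDlo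
  have hTlo' : min (lo / hi) (3 / 8) • B ≤ matT a b α K n Δt :=
    (smul_le_smul_of_le_left hB (min_le_right _ _)).trans hTlo
  refine ⟨hPD, ?_, ?_, ?_⟩
  · have hD0 : 0 ≤ matD a b n r t :=
      (smul_nonneg_loewner hI (div_pos hlo hhi).le).trans hDlo
    have hT0 : 0 ≤ matT a b α K n Δt := (smul_nonneg_loewner hB (by norm_num)).trans hTlo
    exact (nonneg_iff_posSemidef.1 (add_nonneg hD0 hT0)).isHermitian
  · rw [hP, smul_add]
    exact add_le_add hDlo' hTlo'
  · rw [hP, smul_add]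
    exact add_le_add (hDhi.trans (smul_le_smul_of_le_left hI (le_max_left _ _)))
      (hThi.trans (smul_le_smul_of_le_left hB (le_max_right _ _)))

end Multilevel

end RieszFD

theorem theorem3 (d : ℕ) (hd : 1 ≤ d)
    -- the box, the fractional orders, the diffusion coefficients
    (a b : Fin d → ℝ) (hab : ∀ i, a i < b i)
    (α : Fin d → ℝ) (hα : ∀ i, α i ∈ Set.Ioo (1 : ℝ) 2)
    (K : Fin d → ℝ) (hK : ∀ i, 0 < K i)
    -- the variable coefficient on the box times `(0, Tend]`
    (Tend : ℝ) (hTend : 0 < Tend)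
    (r : (Fin d → ℝ) → ℝ → ℝ) (rlo rhi : ℝ) (hrlo : 0 < rlo)
    (hr : ∀ x ∈ RieszFD.openBox a b, ∀ t ∈ Set.Ioc 0 Tend, rlo ≤ r x t ∧ r x t ≤ rhi)
    -- the space and time meshes
    (n : Fin d → ℕ) (hn : ∀ i, 1 ≤ n i)
    (M : ℕ) (hM : 1 ≤ M) (m : ℕ) (hm : m < M)
    (Δt : ℝ) (hΔt : Δt = Tend / M) (tmid : ℝ) (htmid : tmid = ((m : ℝ) + 1 / 2) * Δt)
    -- the average of `r (·, tmid)`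
    (rbar : ℝ)
    (hrbar : rbar ∈ Set.Icc (RieszFD.rCheck a b r tmid) (RieszFD.rHat a b r tmid)) :
    (RieszFD.precond a b α K n Δt rbar).PosDef ∧
    ∀ z : ℂ,
      Module.End.HasEigenvalue
        (Matrix.toLin'
          (((RieszFD.precond a b α K n Δt rbar)⁻¹ *
            (RieszFD.matD a b n r tmid + RieszFD.matT a b α K n Δt)).map
              (fun x : ℝ => (x : ℂ)))) z →
      ∃ lam : ℝ, z = (lam : ℂ) ∧
        min (RieszFD.rCheck a b r tmid / RieszFD.rHat a b r tmid) (3 / 8) ≤ lam ∧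
        lam ≤ max (RieszFD.rHat a b r tmid / RieszFD.rCheck a b r tmid) 2 := by

  subst hΔt
  have hM' : (0 : ℝ) < M := by exact_mod_cast hM
  have hm' : (m : ℝ) + 1 ≤ M := by exact_mod_cast hm
  have hΔ : 0 < Tend / M := div_pos hTend hM'
  have ht : tmid ∈ Set.Ioc 0 Tend := by
    rw [htmid]
    refine ⟨by positivity, ?_⟩
    rw [mul_div_assoc', div_le_iff₀ hM', mul_comm]
    exact mul_le_mul_of_nonneg_left (by linarith) hTend.le
  have hne : ((fun x => r x tmid) '' RieszFD.openBox a b).Nonempty :=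
    (RieszFD.openBox_nonempty hab).image _
  have hbelow : BddBelow ((fun x => r x tmid) '' RieszFD.openBox a b) :=
    ⟨rlo, by rintro _ ⟨x, hx, rfl⟩; exact (hr x hx tmid ht).1⟩
  have habove : BddAbove ((fun x => r x tmid) '' RieszFD.openBox a b) :=
    ⟨rhi, by rintro _ ⟨x, hx, rfl⟩; exact (hr x hx tmid ht).2⟩
  have hlo : 0 < RieszFD.rCheck a b r tmid :=
    hrlo.trans_le (le_csInf hne (by rintro _ ⟨x, hx, rfl⟩; exact (hr x hx tmid ht).1))
  have hη : ∀ i, 0 ≤ RieszFD.eta a b α K n (Tend / M) i := fun i => by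
    have hh : 0 < RieszFD.stepSize a b n i :=
      div_pos (sub_pos.2 (hab i)) (by positivity)
    have := hK i
    rw [RieszFD.eta]
    positivity
  obtain ⟨hPD, hA, h1, h2⟩ := RieszFD.precond_posDef_and_bounds (t := tmid) (r := r) hα hη hlo
    (fun J => ⟨csInf_le hbelow ⟨_, RieszFD.gridPoint_mem_openBox hab n J, rfl⟩,
      le_csSup habove ⟨_, RieszFD.gridPoint_mem_openBox hab n J, rfl⟩⟩) hrbar
  exact ⟨hPD, fun z hz => RieszFD.real_bounds_of_hasEigenvalue_inv_mul hPD hA h1 h2 hz⟩
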